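/- For $n\ge 1$ let $N=2^n$, and for $f:\{0,1\}^n\to\{-1,1\}$ and $z\in\{0,1\}^n$ let $$\widehat f(z)=\frac1{\sqrt N}\sum_{x\in\{0,1\}^n}(-1)^{x\cdot z}f(x).$$ Strings $z_1,\dots,z_n\in\{0,1\}^n$ solve Fourier Fishing on functions $f_1,\dots,f_n:\{0,1\}^n\to\{-1,1\}$ if at least $75\%$ of the indices $i\in\{1,\dots,n\}$ satisfy $|\widehat f_i(z_i)|\ge 1$ and at least $25\%$ of them satisfy $|\widehat f_i(z_i)|\ge 2$. A circuit is an acyclic network of AND, OR and NOT gates with unbounded fan-in and fan-out. Its depth is the maximum number of AND and OR gates on a path from an input to an output (NOT gates are not counted), and its size is its number of AND and OR gates. Theorem. Any depth-$d$ circuit that solves Fourier Fishing with probability at least $0.99$ over uniformly random $f_1,\dots,f_n$ has size $\exp\bigl(\Omega(N^{1/(2d+8)})\bigr)$. That is: there is a constant $c>0$ such that for every $d\ge 0$ there is an $n_0$ with the following property. Let $n\ge n_0$, and let $C$ be a circuit of depth at most $d$ whose input consists of the $nN$ bits of the truth tables of $f_1,\dots,f_n$ and whose output consists of the $n^2$ bits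 of strings $z_1,\dots,z_n\in\{0,1\}^n$. If, for $f_1,\dots,f_n$ chosen independently and uniformly at random, the output of $C$ solves Fourier Fishing on $f_1,\dots,f_n$ with probability at least $0.99$, then $C$ has size at least $\exp\bigl(c\,N^{1/(2d+8)}\bigr)$. -/

import Mathlib

/-! ## Boolean circuits with AND, OR and NOT gates of unbounded fan-in -/

/-- A gate whose inputs are taken from a collection `V` of wires. -/
inductive Gate (V : Type) : Type where
  | and (s : Finset V) : Gate V
  | or (s : Finset V) : Gate V
  | not (v : V) : Gate V

namespace Gate

/-- The bit computed by a gate from the bits on the wires. -/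
def eval {V : Type} (val : V → Bool) : Gate V → Bool
  | and s => decide (∀ v ∈ s, val v = true)
  | or s => decide (∃ v ∈ s, val v = true)
  | not v => !(val v)

/-- The depth of a gate in terms of the depths of the wires. NOT gates do not count. -/
def depthFrom {V : Type} (dep : V → ℕ) : Gate V → ℕ
  | and s => s.sup dep + 1
  | or s => s.sup dep + 1
  | not v => dep v

/-- Is the gate an AND gate or an OR gate? -/
def isAndOr {V : Type} : Gate V → Bool
  | and _ => true
  | or _ => true
  | not _ => false

end Gate

/-- A circuit with input variables `ι` and outputs `ο`: an acyclic network of AND, OR and NOT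
gates with unbounded fan-in and fan-out. The gates are listed in topological order, so that gate
`g` reads from input variables and from gates before `g`; each output is read off an input variable
or a gate. -/
structure Circuit (ι ο : Type) : Type where
  numGates : ℕ
  gate : (g : Fin numGates) → Gate (ι ⊕ Fin g)
  output : ο → ι ⊕ Fin numGates

namespace Circuit

variable {ι ο : Type}

/-- The bit computed at gate `g` on input `x`. -/
def gateValue (C : Circuit ι ο) (x : ι → Bool) (g : Fin C.numGates) : Bool :=
  (C.gate g).eval (Sum.elim x fun h : Fin g => C.gateValue x ⟨h, h.2.trans g.2⟩)
termination_by g.val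

/-- The output of the circuit on input `x`. -/
def eval (C : Circuit ι ο) (x : ι → Bool) (o : ο) : Bool :=
  Sum.elim x (C.gateValue x) (C.output o)

/-- The largest number of AND/OR gates on a path from the inputs up to and including gate `g`. -/
def gateDepth (C : Circuit ι ο) (g : Fin C.numGates) : ℕ :=
  (C.gate g).depthFrom (Sum.elim (fun _ => 0) fun h : Fin g => C.gateDepth ⟨h, h.2.trans g.2⟩)
termination_by g.val

/-- The depth of a circuit: the largest number of AND/OR gates on a path to an output. -/
def depth [Fintype ο] (C : Circuit ι ο) : ℕ :=
  Finset.univ.sup fun o => Sum.elim (fun _ => 0) C.gateDepth (C.output o)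

/-- The size of a circuit: its number of AND and OR gates. (Not counting the NOT gates can only
make the size smaller, hence a lower bound on it stronger.) -/
def size (C : Circuit ι ο) : ℕ :=
  (Finset.univ.filter fun g => (C.gate g).isAndOr = true).card

end Circuit

/-! ## Fourier Fishing -/

/-- The set `{0,1}^n`. -/
abbrev Cube (n : ℕ) : Type := Fin n → Bool

/-- The inner product `x · z`, the number of common ones of `x` and `z`. -/
def dotBits {n : ℕ} (x z : Cube n) : ℕ :=
  (Finset.univ.filter fun i => x i = true ∧ z i = true).card

/-- The element of `{-1, 1}` that a bit stands for: `b ↦ (-1)^b`. -/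
def signOfBit (b : Bool) : ℝ := if b then -1 else 1

/-- The Fourier transform of the function `x ↦ (-1)^(f x)` from `{0,1}^n` to `{-1,1}`, which is
given by the truth table `f`, normalized by `1/√N` with `N = 2^n`. -/
noncomputable def cubeFourier {n : ℕ} (f : Cube n → Bool) (z : Cube n) : ℝ :=
  1 / Real.sqrt ((2 : ℝ) ^ n) * ∑ x : Cube n, (-1 : ℝ) ^ dotBits x z * signOfBit (f x)

open Classical in
/-- The strings `z 1, …, z n` are a valid answer to Fourier Fishing on `f 1, …, f n`: at least 75%
of the coefficients `cubeFourier (f i) (z i)` have absolute value at least 1, and at least 25% have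
absolute value at least 2. -/
def FourierFishingValid {n : ℕ} (f : Fin n → Cube n → Bool) (z : Fin n → Cube n) : Prop :=
  (75 / 100 : ℝ) * n ≤ ((Finset.univ.filter fun i => 1 ≤ |cubeFourier (f i) (z i)|).card : ℝ) ∧
  (25 / 100 : ℝ) * n ≤ ((Finset.univ.filter fun i => 2 ≤ |cubeFourier (f i) (z i)|).card : ℝ)

/-- A circuit that takes the truth tables of `n` Boolean functions on `{0,1}^n` (input variable
`(i, x)` is the bit of `f i` at `x`) and outputs `n` strings in `{0,1}^n` (output `(i, j)` is the
`j`-th bit of the `i`-th string). -/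
abbrev FishingCircuit (n : ℕ) : Type := Circuit (Fin n × Cube n) (Fin n × Fin n)

/-- The strings that the circuit outputs on `f 1, …, f n`. -/
def FishingCircuit.answer {n : ℕ} (C : FishingCircuit n) (f : Fin n → Cube n → Bool) :
    Fin n → Cube n :=
  fun i j => Circuit.eval C (fun p => f p.1 p.2) (i, j)

open Classical in
/-- The probability, over independent uniformly random `f 1, …, f n`, that the circuit outputs a
valid answer to Fourier Fishing. -/
noncomputable def FishingCircuit.successProb {n : ℕ} (C : FishingCircuit n) : ℝ :=
  ((Finset.univ.filter fun f : Fin n → Cube n → Bool =>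
      FourierFishingValid f (FishingCircuit.answer C f)).card : ℝ) /
    (Fintype.card (Fin n → Cube n → Bool) : ℝ)

/-! A valid answer has `∑ i, cubeFourier (f i) (z i) ^ 2 ≥ 3n/2`, while strings that do not depend
on the input give mean `n`. A successful circuit must therefore choose some string `z i` so that the
second moment of its unnormalized coefficient exceeds `N` by an amount of order `N`. The proof
bounds this excess for small circuits.

The excess is a sum over pairs of distinct input variables, in which the two signs occur as a
product. A random restriction that keeps each variable free with probability `p` therefore
multiplies it, on average, by exactly `p ^ 2` (`restriction_secondMomentExcess`). With `p =
1/(64t)`, the switching lemma (`switching`) and a union bound replace the gates of the next depth by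
decision trees of depth `t`, except with probability `size * 4 ^ (-(t + 1))`. After `d` rounds the
`n` bits of one string come from a tree of depth `nt`. The excess of such a tree is at most `(nt) ^
2` (`HasDepth.secondMomentExcess_le`), because the variables it has not queried are still
independent of its output. Undoing the rounds gives the bound `(2 * (64t) ^ 2) ^ d * (nt) ^ 2`,
which is far below `N` when `t` is of order `N ^ (1/(2d+8))`.

The switching lemma is proved by induction on the terms. Conditioning on earlier terms being
falsified is absorbed into a nonnegative weight on restrictions that increases as more variables are
fixed. -/

/-! ## Decision trees -/

/-- `HasDepth k f`: the function `f` of the bits `x v` is computed by a decision tree of depth at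
most `k`. -/
inductive HasDepth {V β : Type} [DecidableEq V] : ℕ → ((V → Bool) → β) → Prop
  | const (k : ℕ) (c : β) : HasDepth k (fun _ => c)
  | query (k : ℕ) (v : V) (f : (V → Bool) → β)
      (h : ∀ b, HasDepth k (fun x => f (Function.update x v b))) : HasDepth (k + 1) f

/-- The assignment that agrees with the partial assignment `σ` where `σ` is defined, and with `x`
elsewhere. -/
def override {V : Type} (σ : V → Option Bool) (x : V → Bool) : V → Bool :=
  fun v => (σ v).getD (x v)

section DecisionTrees

variable {V β γ : Type} [DecidableEq V]

theorem HasDepth.mono {k l : ℕ} {f : (V → Bool) → β} (h : HasDepth k f) (hl : k ≤ l) :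
    HasDepth l f := by
  induction h generalizing l with
  | const k c => exact .const l c
  | query k v f _ ih =>
    obtain ⟨l, rfl⟩ : ∃ m, l = m + 1 := ⟨l - 1, by omega⟩
    exact .query l v f fun b => ih b (by omega)

theorem HasDepth.map {k : ℕ} {f : (V → Bool) → β} (h : HasDepth k f) (φ : β → γ) :
    HasDepth k (fun x => φ (f x)) := by
  induction h with
  | const k c => exact .const k (φ c)
  | query k v f _ ih => exact .query k v _ ih

theorem HasDepth.var (v : V) : HasDepth 1 (fun x : V → Bool => x v) :=
  .query 0 v _ fun b => by simpa using HasDepth.const 0 b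

theorem HasDepth.comp_override {k : ℕ} {f : (V → Bool) → β} (h : HasDepth k f)
    (σ : V → Option Bool) : HasDepth k (fun x => f (override σ x)) := by
  induction h with
  | const k c => exact .const k c
  | query k v f _ ih =>
    rcases hv : σ v with _ | b
    · refine .query k v _ fun b => ?_
      convert ih b using 3 with x
      funext u
      by_cases hu : u = v
      · subst hu; simp [override, hv]
      · simp [override, hu]
    · refine HasDepth.mono (k := k) ?_ (by omega)
      convert ih b using 3 with x
      funext u
      by_cases hu : u = v
      · subst hu; simp [override, hv]
      · simp [override, hu]

theorem HasDepth.comp_update {k : ℕ} {f : (V → Bool) → β} (h : HasDepth k f) (v : V) (b : Bool) :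
    HasDepth k (fun x => f (Function.update x v b)) := by
  convert h.comp_override (fun u => if u = v then some b else none) using 3 with x
  funext u
  by_cases hu : u = v
  · subst hu; simp [override]
  · simp [override, hu]

theorem HasDepth.prodMk {k l : ℕ} {f : (V → Bool) → β} {g : (V → Bool) → γ} (hf : HasDepth k f)
    (hg : HasDepth l g) : HasDepth (k + l) (fun x => (f x, g x)) := by
  induction hf generalizing g with
  | const k c => exact (hg.map fun z => (c, z)).mono (by omega)
  | query k v f _ ih =>
    have := HasDepth.query (k + l) v (fun x => (f x, g x)) fun b => ih b (hg.comp_update v b)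
    exact this.mono (by omega)

theorem HasDepth.pi {ι : Type} [DecidableEq ι] [Fintype ι] {k : ℕ} {f : ι → (V → Bool) → Bool}
    (h : ∀ i, HasDepth k (f i)) : HasDepth (Fintype.card ι * k) (fun x i => f i x) := by
  have key : ∀ s : Finset ι, HasDepth (s.card * k) (fun x i => if i ∈ s then f i x else false) := by
    intro s
    induction s using Finset.induction_on with
    | empty => simpa using HasDepth.const 0 fun _ : ι => false
    | insert i s hi ih =>
      have := ((h i).prodMk ih).map fun z (j : ι) => if j = i then z.1 else z.2 j
      rw [Finset.card_insert_of_notMem hi]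
      refine HasDepth.mono (k := k + s.card * k) ?_ (by ring_nf; rfl)
      convert this using 3 with x j
      by_cases hj : j = i
      · subst hj; simp
      · simp [hj]
  simpa using key Finset.univ

/-- A tree may query all of `T` first; `P` records which of these variables are true. -/
theorem HasDepth.of_forall_subset {k : ℕ} (T : Finset V) {f : (V → Bool) → β}
    (h : ∀ P ⊆ T, HasDepth k (fun x => f (fun v => if v ∈ T then decide (v ∈ P) else x v))) :
    HasDepth (k + T.card) f := by
  induction T using Finset.induction_on generalizing f with
  | empty => simpa using h ∅ le_rfl
  | insert v T hv ih =>
    rw [Finset.card_insert_of_notMem hv, ← add_assoc]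
    refine .query _ v f fun b => ih fun P hP => ?_
    have hvP : v ∉ P := fun h => hv (hP h)
    convert h (if b then insert v P else P) ?_ using 3 with x
    · funext u
      by_cases hu : u = v
      · subst hu
        cases b <;> simp [hvP]
      · cases b <;> simp [hu]
    · cases b
      · exact hP.trans (Finset.subset_insert _ _)
      · exact Finset.insert_subset_insert _ hP

end DecisionTrees

/-! ## Disjunctive normal forms -/

/-- The term `(U, a)` is the conjunction of the conditions `x v = a v` for `v ∈ U`. -/
def termEval {V : Type} (τ : Finset V × (V → Bool)) (x : V → Bool) : Bool :=
  decide (∀ v ∈ τ.1, x v = τ.2 v)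

/-- The disjunction of a list of terms. -/
def dnfEval {V : Type} (L : List (Finset V × (V → Bool))) (x : V → Bool) : Bool :=
  L.any fun τ => termEval τ x

/-- The terms are the paths of the tree that end in a leaf labelled true. -/
theorem HasDepth.exists_dnf {V : Type} [DecidableEq V] {k : ℕ} {f : (V → Bool) → Bool}
    (h : HasDepth k f) : ∃ L : List (Finset V × (V → Bool)),
      (∀ τ ∈ L, τ.1.card ≤ k) ∧ ∀ x, f x = dnfEval L x := by
  induction h with
  | const k c =>
    cases c
    · exact ⟨[], by simp, fun x => by simp [dnfEval]⟩
    · exact ⟨[(∅, fun _ => true)], by simp, fun x => by simp [dnfEval, termEval]⟩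
  | query k v f _ ih =>
    choose L hL hf using ih
    -- A term of the subtree may already mention `v`. Its condition there is overwritten, which is
    -- harmless because the subtree's function ignores `v`.
    let F (b : Bool) (τ : Finset V × (V → Bool)) : Finset V × (V → Bool) :=
      (insert v τ.1, Function.update τ.2 v b)
    refine ⟨(L true).map (F true) ++ (L false).map (F false), ?_, fun x => ?_⟩
    · have : ∀ b, ∀ τ ∈ (L b).map (F b), τ.1.card ≤ k + 1 := by
        intro b τ hτ
        obtain ⟨τ', hτ', rfl⟩ := List.mem_map.1 hτ
        exact (Finset.card_insert_le _ _).trans (Nat.succ_le_succ (hL b τ' hτ'))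
      intro τ hτ
      rcases List.mem_append.1 hτ with hτ | hτ
      exacts [this _ _ hτ, this _ _ hτ]
    · have sound : ∀ b, dnfEval ((L b).map (F b)) x = true → f x = true := by
        intro b hb
        simp only [dnfEval, List.any_map, List.any_eq_true, Function.comp_apply, termEval,
          decide_eq_true_eq, F] at hb
        obtain ⟨τ, hτ, hx⟩ := hb
        have hxv : x v = b := by simpa using hx v (Finset.mem_insert_self _ _)
        have h1 : dnfEval (L b) (Function.update x v (τ.2 v)) = true := by
          simp only [dnfEval, List.any_eq_true, termEval, decide_eq_true_eq]
          refine ⟨τ, hτ, fun u hu => ?_⟩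
          by_cases huv : u = v
          · subst huv; simp
          · simpa [huv] using hx u (Finset.mem_insert_of_mem hu)
        rw [← hf] at h1
        simpa [← hxv] using h1
      have complete : f x = true → dnfEval ((L (x v)).map (F (x v))) x = true := by
        intro hx
        have h1 : dnfEval (L (x v)) x = true := by rw [← hf]; simpa using hx
        simp only [dnfEval, List.any_map, List.any_eq_true, Function.comp_apply, termEval,
          decide_eq_true_eq, F] at h1 ⊢
        obtain ⟨τ, hτ, hxτ⟩ := h1
        refine ⟨τ, hτ, fun u hu => ?_⟩
        by_cases huv : u = v
        · subst huv; simp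
        · simpa [huv] using hxτ u (Finset.mem_of_mem_insert_of_ne hu huv)
      have happ : dnfEval ((L true).map (F true) ++ (L false).map (F false)) x =
          (dnfEval ((L true).map (F true)) x || dnfEval ((L false).map (F false)) x) := by
        simp [dnfEval]
      rw [happ, Bool.eq_iff_iff, Bool.or_eq_true]
      refine ⟨fun hx => ?_, fun hx => hx.elim (sound _) (sound _)⟩
      have := complete hx
      cases hxv : x v <;> rw [hxv] at this
      exacts [.inr this, .inl this]

/-! ## Means over product distributions -/

/-- The mean of `H x` when the coordinates of `x` are independent with distribution `w`. -/
noncomputable def prodMean {V α : Type} [Fintype V] [DecidableEq V] [Fintype α] (w : α → ℝ)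
    (H : (V → α) → ℝ) : ℝ :=
  ∑ x, (∏ v, w (x v)) * H x

section ProdMean

variable {V α ι : Type} [Fintype V] [DecidableEq V] [Fintype α] {w : α → ℝ}

theorem prodMean_mono (hw : ∀ a, 0 ≤ w a) {H K : (V → α) → ℝ} (h : ∀ x, H x ≤ K x) :
    prodMean w H ≤ prodMean w K :=
  Finset.sum_le_sum fun x _ =>
    mul_le_mul_of_nonneg_left (h x) (Finset.prod_nonneg fun _ _ => hw _)

theorem prodMean_const (hw : ∑ a, w a = 1) (c : ℝ) : prodMean w (fun _ : V → α => c) = c := by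
  classical
  have h := Finset.prod_univ_sum (fun _ : V => (Finset.univ : Finset α)) (fun _ a => w a)
  rw [Fintype.piFinset_univ] at h
  rw [prodMean, ← Finset.sum_mul, ← h]
  simp [hw]

theorem prodMean_nonneg (hw : ∀ a, 0 ≤ w a) {H : (V → α) → ℝ} (h : ∀ x, 0 ≤ H x) :
    0 ≤ prodMean w H :=
  Finset.sum_nonneg fun x _ => mul_nonneg (Finset.prod_nonneg fun _ _ => hw _) (h x)

theorem prodMean_add (H K : (V → α) → ℝ) :
    prodMean w (fun x => H x + K x) = prodMean w H + prodMean w K := by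
  simp [prodMean, mul_add, Finset.sum_add_distrib]

theorem prodMean_const_mul (c : ℝ) (H : (V → α) → ℝ) :
    prodMean w (fun x => c * H x) = c * prodMean w H := by
  simp only [prodMean, Finset.mul_sum]
  exact Finset.sum_congr rfl fun x _ => by ring

theorem prodMean_sum (s : Finset ι) (H : ι → (V → α) → ℝ) :
    prodMean w (fun x => ∑ i ∈ s, H i x) = ∑ i ∈ s, prodMean w (H i) := by
  simp only [prodMean, Finset.mul_sum]
  exact Finset.sum_comm

/-- Resampling the coordinate `v`. -/
theorem prodMean_update (hw : ∑ a, w a = 1) (v : V) (H : (V → α) → ℝ) :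
    prodMean w H = ∑ a, w a * prodMean w (fun x => H (Function.update x v a)) := by
  have hswap : ∀ (a : α) (x : V → α),
      w a * ∏ u, w (x u) = w (x v) * ∏ u, w (Function.update x v a u) := by
    intro a x
    rw [← Finset.mul_prod_erase _ _ (Finset.mem_univ v),
      ← Finset.mul_prod_erase _ (fun u => w (Function.update x v a u)) (Finset.mem_univ v)]
    have : ∏ u ∈ Finset.univ.erase v, w (Function.update x v a u) =
        ∏ u ∈ Finset.univ.erase v, w (x u) :=
      Finset.prod_congr rfl fun u hu => by
        rw [Function.update_of_ne (Finset.ne_of_mem_erase hu)]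
    rw [this, Function.update_self]
    ring
  -- The involution that swaps a fresh sample with the coordinate `v`; it preserves the product
  -- weight.
  let e : α × (V → α) ≃ α × (V → α) :=
    { toFun := fun z => (z.2 v, Function.update z.2 v z.1)
      invFun := fun z => (z.2 v, Function.update z.2 v z.1)
      left_inv := fun z => by simp
      right_inv := fun z => by simp }
  calc prodMean w H
      = ∑ z : α × (V → α), w z.1 * ((∏ u, w (z.2 u)) * H z.2) := by
        rw [Fintype.sum_prod_type]
        simp only [← Finset.mul_sum]
        rw [← Finset.sum_mul, hw, one_mul, prodMean]
    _ = ∑ z : α × (V → α), w z.1 * ((∏ u, w (z.2 u)) * H (Function.update z.2 v z.1)) := by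
        rw [← e.sum_comp]
        refine Finset.sum_congr rfl fun z _ => ?_
        have := hswap z.1 z.2
        simp only [e, Equiv.coe_fn_mk]
        rw [← mul_assoc, ← mul_assoc, this]
    _ = ∑ a, w a * prodMean w (fun x => H (Function.update x v a)) := by
        rw [Fintype.sum_prod_type]
        simp only [prodMean, Finset.mul_sum]

end ProdMean

/-! ## Random restrictions and the switching lemma -/

/-- The distribution of one coordinate of a random restriction: free with probability `p`,
otherwise a uniform bit. -/
noncomputable def starWeight (p : ℝ) : Option Bool → ℝ
  | none => p
  | some _ => (1 - p) / 2

theorem sum_starWeight (p : ℝ) : ∑ o, starWeight p o = 1 := by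
  rw [Fintype.sum_option]
  simp [starWeight]
  ring

theorem starWeight_nonneg {p : ℝ} (h0 : 0 ≤ p) (h1 : p ≤ 1) (o : Option Bool) :
    0 ≤ starWeight p o := by
  cases o
  · exact h0
  · simp only [starWeight]; linarith

/-- The restriction `ρ` falsifies none of the conditions `x v = a v`, `v ∈ U`. -/
def Alive {V : Type} (U : Finset V) (a : V → Bool) (ρ : V → Option Bool) : Prop :=
  ∀ v ∈ U, ρ v ≠ some (!a v)

/-- The restriction `ρ`, changed on `U`: free on `T`, equal to `a` on `U \ T`. -/
def pattern {V : Type} [DecidableEq V] (U : Finset V) (a : V → Bool) (T : Finset V)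
    (ρ : V → Option Bool) : V → Option Bool :=
  fun v => if v ∈ U then (if v ∈ T then none else some (a v)) else ρ v

/-- `Bad s f`: no decision tree of depth less than `s` computes `f`. -/
def Bad {V : Type} [DecidableEq V] (s : ℕ) (f : (V → Bool) → Bool) : Prop :=
  ∀ k < s, ¬HasDepth k f

/-- Functions of restrictions that increase when more variables are fixed. -/
def Increasing {V : Type} (g : (V → Option Bool) → ℝ) : Prop :=
  ∀ ρ ρ', (∀ v, ρ v = none ∨ ρ' v = ρ v) → g ρ ≤ g ρ'

section Switching

variable {V : Type} [Fintype V] [DecidableEq V]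

-- If a term survives, each of its variables is independently free (weight `p`) or set to the
-- required value (weight `(1 - p) / 2`). The sum runs over the set `T` of free ones.
open Classical in
theorem prodMean_alive (p : ℝ) (U : Finset V) (a : V → Bool) (H : (V → Option Bool) → ℝ) :
    prodMean (starWeight p) (fun ρ => if Alive U a ρ then H ρ else 0) =
      ∑ T ∈ U.powerset, p ^ T.card * ((1 - p) / 2) ^ (U.card - T.card) *
        prodMean (starWeight p) (fun ρ => H (pattern U a T ρ)) := by
  induction U using Finset.induction_on generalizing H with
  | empty =>
    have h : ∀ ρ, pattern ∅ a ∅ ρ = ρ := fun ρ => by funext v; simp [pattern]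
    simp [Alive, h]
  | insert v U hv ih =>
    have halive : ∀ o ρ, Alive (insert v U) a (Function.update ρ v o) ↔
        o ≠ some (!a v) ∧ Alive U a ρ := by
      intro o ρ
      simp only [Alive, Finset.forall_mem_insert, Function.update_self]
      refine and_congr_right fun _ => forall₂_congr fun u hu => ?_
      rw [Function.update_of_ne (by rintro rfl; exact hv hu)]
    have hkey : ∀ o, o ≠ some (!a v) →
        prodMean (starWeight p) (fun ρ => if Alive (insert v U) a (Function.update ρ v o) then
          H (Function.update ρ v o) else 0) =
        ∑ T ∈ U.powerset, p ^ T.card * ((1 - p) / 2) ^ (U.card - T.card) *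
          prodMean (starWeight p) (fun ρ => H (Function.update (pattern U a T ρ) v o)) := by
      intro o ho
      rw [← ih fun ρ => H (Function.update ρ v o)]
      simp only [halive, ho, ne_eq, not_false_eq_true, true_and]
    have hdead : prodMean (starWeight p) (fun ρ => if Alive (insert v U) a
        (Function.update ρ v (some (!a v))) then H (Function.update ρ v (some (!a v))) else 0)
          = 0 := by
      simp [halive, prodMean]
    have hp1 : ∀ T ∈ U.powerset, ∀ ρ, Function.update (pattern U a T ρ) v none =
        pattern (insert v U) a (insert v T) ρ := by
      intro T hT ρ
      funext u
      by_cases hu : u = v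
      · subst hu; simp [pattern]
      · simp [pattern, hu]
    have hp2 : ∀ T ∈ U.powerset, ∀ ρ, Function.update (pattern U a T ρ) v (some (a v)) =
        pattern (insert v U) a T ρ := by
      intro T hT ρ
      have hvT : v ∉ T := fun h => hv (Finset.mem_powerset.1 hT h)
      funext u
      by_cases hu : u = v
      · subst hu; simp [pattern, hvT]
      · simp [pattern, hu]
    have hsplit : ∀ F : Option Bool → ℝ, ∑ o, F o =
        F none + F (some (a v)) + F (some (!a v)) := by
      intro F
      rw [Fintype.sum_option, Fintype.sum_bool]
      cases a v <;> simp <;> ring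
    rw [prodMean_update (sum_starWeight p) v, hsplit, hdead, mul_zero, add_zero,
      hkey none (by simp), hkey (some (a v)) (by cases a v <;> simp),
      Finset.sum_powerset_insert hv, add_comm, Finset.mul_sum, Finset.mul_sum]
    congr 1
    · refine Finset.sum_congr rfl fun T hT => ?_
      have hle := Finset.card_le_card (Finset.mem_powerset.1 hT)
      simp only [hp2 T hT, starWeight]
      rw [Finset.card_insert_of_notMem hv, Nat.succ_sub hle, pow_succ]
      ring
    · refine Finset.sum_congr rfl fun T hT => ?_
      have hvT : v ∉ T := fun h => hv (Finset.mem_powerset.1 hT h)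
      simp only [hp1 T hT, starWeight]
      rw [Finset.card_insert_of_notMem hv, Finset.card_insert_of_notMem hvT, Nat.add_sub_add_right,
        pow_succ]
      ring

end Switching

theorem Bad.eq_zero_of_const {V : Type} [DecidableEq V] {s : ℕ} {c : Bool}
    (h : Bad s (fun _ : V → Bool => c)) : s = 0 := by
  by_contra hs
  exact h 0 (by omega) (.const 0 c)

/-- Otherwise querying `T` and continuing with the shallow trees would compute `f` in depth less
than `s`. -/
theorem Bad.exists_subset {V : Type} [DecidableEq V] {s : ℕ} {f : (V → Bool) → Bool}
    (h : Bad s f) (T : Finset V) :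
    ∃ P ∈ T.powerset,
      Bad (s - T.card) (fun x => f (fun v => if v ∈ T then decide (v ∈ P) else x v)) := by
  by_contra! hc
  have hc' : ∀ P ⊆ T, ∃ k < s - T.card,
      HasDepth k (fun x => f (fun v => if v ∈ T then decide (v ∈ P) else x v)) := by
    intro P hP
    have := hc P (Finset.mem_powerset.2 hP)
    simp only [Bad] at this
    push Not at this
    exact this
  -- Needed only for `T.card < s`, so that the truncated subtraction is exact.
  obtain ⟨k, hk, -⟩ := hc' ∅ (Finset.empty_subset _)
  refine h (s - T.card - 1 + T.card) (by omega) (HasDepth.of_forall_subset T fun P hP => ?_)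
  obtain ⟨k, hk, h⟩ := hc' P hP
  exact h.mono (by omega)

theorem dnfEval_cons {V : Type} (τ : Finset V × (V → Bool)) (L : List (Finset V × (V → Bool)))
    (x : V → Bool) : dnfEval (τ :: L) x = (termEval τ x || dnfEval L x) := by
  simp [dnfEval]

theorem Increasing.comp_pattern {V : Type} [DecidableEq V] {g : (V → Option Bool) → ℝ}
    (hg : Increasing g) (U : Finset V) (a : V → Bool) (T : Finset V) :
    Increasing (fun ρ => g (pattern U a T ρ)) := by
  intro ρ ρ' h
  refine hg _ _ fun v => ?_
  by_cases hv : v ∈ U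
  · right; simp [pattern, hv]
  · simpa [pattern, hv] using h v

/-- This compares the contribution of every free set `T` with that of `T = ∅`, where the term is
satisfied. -/
theorem Increasing.pattern_le {V : Type} [DecidableEq V] {g : (V → Option Bool) → ℝ}
    (hg : Increasing g) (U : Finset V) (a : V → Bool) (T : Finset V) (ρ : V → Option Bool) :
    g (pattern U a T ρ) ≤ g (pattern U a ∅ ρ) := by
  refine hg _ _ fun v => ?_
  by_cases hv : v ∈ U
  · by_cases hT : v ∈ T
    · left; simp [pattern, hv, hT]
    · right; simp [pattern, hv, hT]
  · right; simp [pattern, hv]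

-- A falsified term stays falsified when more variables are fixed. So the event that a term is dead
-- can join the weight, which keeps the induction in the switching lemma going.
open Classical in
theorem Increasing.ite_alive {V : Type} {g : (V → Option Bool) → ℝ}
    (hg : Increasing g) (h0 : ∀ ρ, 0 ≤ g ρ) (U : Finset V) (a : V → Bool) :
    Increasing (fun ρ => if Alive U a ρ then 0 else g ρ) := by
  intro ρ ρ' h
  by_cases hρ : Alive U a ρ
  · simp only [hρ, if_true]
    split_ifs
    exacts [le_rfl, h0 _]
  · have hρ' : ¬Alive U a ρ' := by
      simp only [Alive] at hρ ⊢
      push Not at hρ ⊢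
      obtain ⟨v, hv, hva⟩ := hρ
      refine ⟨v, hv, ?_⟩
      rcases h v with h | h
      · rw [h] at hva; simp at hva
      · rw [h, hva]
    simpa only [hρ, hρ', if_false] using hg ρ ρ' h

/-- The conditions of a term that are left after it has survived the restriction `σ`, written with
the free variables `T` of the term set to the indicator function of `P`. -/
theorem termEval_override_pattern {V : Type} [DecidableEq V] {σ : V → Option Bool}
    {U₀ : Finset V} {a : V → Bool} (hσ : Alive U₀ a σ) (T P : Finset V)
    (x : V → Bool) (ρ : V → Option Bool)  :
    termEval (U₀, a) (override (fun v => if v ∈ U₀.filter (σ · = none) then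
      some (if v ∈ T then decide (v ∈ P) else a v) else σ v) (override ρ x)) =
    decide (∀ v ∈ U₀.filter (σ · = none), v ∈ T → decide (v ∈ P) = a v) := by
  rw [termEval]
  congr 1
  rw [eq_iff_iff]
  constructor
  · intro h v hv hT
    have := h v (Finset.mem_filter.1 hv).1
    simpa [override, hv, hT, (Finset.mem_filter.1 hv).1, (Finset.mem_filter.1 hv).2] using this
  · intro h v hv
    rcases hσv : σ v with _ | b
    · have hvU : v ∈ U₀.filter (σ · = none) := Finset.mem_filter.2 ⟨hv, hσv⟩
      by_cases hT : v ∈ T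
      · simpa only [override, hvU, hT, if_true, Option.getD_some] using h v hvU hT
      · simp only [override, hvU, hT, if_true, if_false, Option.getD_some]
    · have := hσ v hv
      rw [hσv] at this
      simp only [override, Finset.mem_filter, hσv, reduceCtorEq, and_false, if_false,
        Option.getD_some]
      cases b <;> cases h : a v <;> simp_all

open Classical in
/-- **Switching lemma**, relative to an increasing weight `g`. -/
theorem switching_weighted {V : Type} [Fintype V] [DecidableEq V] {p α : ℝ} {w : ℕ} (hp0 : 0 ≤ p)
    (hp1 : p ≤ 1) (hα0 : 0 < α) (hα1 : α ≤ 1)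
    (hw : ∀ m ≤ w, (p * (2 / α) + (1 - p) / 2) ^ m ≤ 2 * ((1 - p) / 2) ^ m)
    (L : List (Finset V × (V → Bool))) (hL : ∀ τ ∈ L, τ.1.card ≤ w) (σ : V → Option Bool)
    (s : ℕ) (g : (V → Option Bool) → ℝ) (hg : Increasing g) (hg0 : ∀ ρ, 0 ≤ g ρ) :
    prodMean (starWeight p) (fun ρ =>
      if Bad s (fun x => dnfEval L (override σ (override ρ x))) then g ρ else 0) ≤
    α ^ s * prodMean (starWeight p) g := by
  have hnn := starWeight_nonneg hp0 hp1
  have htriv : ∀ (s : ℕ) (K : List (Finset V × (V → Bool))) (σ : V → Option Bool)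
      (g : (V → Option Bool) → ℝ), (∀ ρ, 0 ≤ g ρ) →
      prodMean (starWeight p) (fun ρ =>
        if Bad s (fun x => dnfEval K (override σ (override ρ x))) then g ρ else 0) ≤
      prodMean (starWeight p) g := fun s K σ g hg0 =>
    prodMean_mono hnn fun ρ => by split_ifs; exacts [le_rfl, hg0 ρ]
  induction L generalizing σ s g with
  | nil =>
    rcases Nat.eq_zero_or_pos s with rfl | hs
    · simpa using htriv 0 [] σ g hg0
    · have : ∀ ρ : V → Option Bool,
          ¬Bad s (fun x => dnfEval [] (override σ (override ρ x))) := fun ρ h => by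
        have := Bad.eq_zero_of_const (c := false) h
        omega
      simp only [this, if_false]
      rw [prodMean_const (sum_starWeight p)]
      exact mul_nonneg (pow_nonneg hα0.le _) (prodMean_nonneg hnn hg0)
  | cons τ L ih =>
    obtain ⟨U₀, a⟩ := τ
    have hL' : ∀ τ ∈ L, τ.1.card ≤ w := fun τ hτ => hL τ (List.mem_cons_of_mem _ hτ)
    rcases Nat.eq_zero_or_pos s with rfl | hs
    · simpa using htriv 0 _ σ g hg0
    by_cases hσ : Alive U₀ a σ
    swap
    · have hkill : ∀ y : V → Bool, termEval (U₀, a) (override σ y) = false := by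
        intro y
        simp only [Alive] at hσ
        push Not at hσ
        obtain ⟨v, hv, hva⟩ := hσ
        simp only [termEval, decide_eq_false_iff_not]
        intro h
        have := h v hv
        simp [override, hva] at this
      simp only [dnfEval_cons, hkill, Bool.false_or]
      exact ih hL' σ s g hg hg0
    -- Since the term is alive under `σ`, its variables outside `U` are already satisfied; only `U`
    -- matters.
    set U := U₀.filter (σ · = none) with hU
    set m := U.card with hm
    set q := (1 - p) / 2 with hq
    have hq0 : 0 ≤ q := by rw [hq]; linarith
    have hmw : m ≤ w := (Finset.card_filter_le _ _).trans (hL _ List.mem_cons_self)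
    set f : (V → Option Bool) → (V → Bool) → Bool :=
      fun ρ x => dnfEval ((U₀, a) :: L) (override σ (override ρ x)) with hf
    set G := prodMean (starWeight p) (fun ρ => g (pattern U a ∅ ρ)) with hG
    have hG0 : 0 ≤ G := prodMean_nonneg hnn fun ρ => hg0 _
    -- the part where the first term is falsified
    have hdead : prodMean (starWeight p) (fun ρ => if Bad s (f ρ) then
        (if Alive U a ρ then 0 else g ρ) else 0) ≤
        α ^ s * prodMean (starWeight p) (fun ρ => if Alive U a ρ then 0 else g ρ) := by
      refine le_trans (prodMean_mono hnn fun ρ => ?_) (ih hL' σ s _ (hg.ite_alive hg0 U a)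
        (fun ρ => by split_ifs; exacts [le_rfl, hg0 ρ]))
      by_cases hρ : Alive U a ρ
      · simp [hρ]
      · have hkill : ∀ x : V → Bool, termEval (U₀, a) (override σ (override ρ x)) = false := by
          intro x
          simp only [Alive] at hρ
          push Not at hρ
          obtain ⟨v, hv, hva⟩ := hρ
          simp only [termEval, decide_eq_false_iff_not]
          intro h
          have := h v (Finset.mem_filter.1 hv).1
          simp [override, hva, (Finset.mem_filter.1 hv).2] at this
        simp only [hf, dnfEval_cons, hkill, Bool.false_or, le_refl]
    -- a set `T` of free variables in the first term
    have hT : ∀ T ∈ U.powerset, T ≠ ∅ →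
        prodMean (starWeight p) (fun ρ => if Bad s (f (pattern U a T ρ)) then
          g (pattern U a T ρ) else 0) ≤ (2 / α) ^ T.card * (α ^ s * G) := by
      intro T hTU _
      have hTU' := Finset.mem_powerset.1 hTU
      -- All of `U` becomes fixed: the free variables `T` by the answers `P`, the others as the term
      -- requires. The value of `ρ` on `U` then no longer matters, and the induction hypothesis
      -- applies to the remaining terms.
      set σ' : Finset V → V → Option Bool := fun P v =>
        if v ∈ U then some (if v ∈ T then decide (v ∈ P) else a v) else σ v with hσ'
      have hov : ∀ P ρ x, f (pattern U a T ρ)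
          (fun v => if v ∈ T then decide (v ∈ P) else x v) =
          dnfEval ((U₀, a) :: L) (override (σ' P) (override ρ x)) := by
        intro P ρ x
        simp only [hf]
        congr 1
        funext v
        by_cases hv : v ∈ U
        · have hσv := (Finset.mem_filter.1 hv).2
          by_cases hvT : v ∈ T <;> simp [override, hσ', hσv, hv, hvT, pattern]
        · have hvT : v ∉ T := fun h => hv (hTU' h)
          simp [override, hσ', hv, hvT, pattern]
      have hpt : ∀ ρ, (if Bad s (f (pattern U a T ρ)) then g (pattern U a T ρ) else 0) ≤
          ∑ P ∈ T.powerset, if Bad (s - T.card)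
            (fun x => dnfEval L (override (σ' P) (override ρ x))) then
              g (pattern U a T ρ) else 0 := by
        intro ρ
        have hnonneg : ∀ P ∈ T.powerset, 0 ≤ if Bad (s - T.card)
            (fun x => dnfEval L (override (σ' P) (override ρ x))) then
              g (pattern U a T ρ) else 0 := fun P _ => by split_ifs; exacts [hg0 _, le_rfl]
        split_ifs with hbad
        swap
        · exact Finset.sum_nonneg hnonneg
        obtain ⟨P, hP, hbadP⟩ := hbad.exists_subset T
        have hbadL : Bad (s - T.card) (fun x => dnfEval L (override (σ' P) (override ρ x))) := by
          have hterm : ∀ x, termEval (U₀, a) (override (σ' P) (override ρ x)) =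
              decide (∀ v ∈ U, v ∈ T → decide (v ∈ P) = a v) := fun x => by
            convert termEval_override_pattern hσ T P x ρ
          simp only [hov, dnfEval_cons, hterm] at hbadP
          by_cases hc : ∀ v ∈ U, v ∈ T → decide (v ∈ P) = a v
          · simp only [decide_eq_true hc, Bool.true_or] at hbadP
            rw [hbadP.eq_zero_of_const]
            intro k hk
            omega
          · simpa only [decide_eq_false hc, Bool.false_or] using hbadP
        calc g (pattern U a T ρ) = if Bad (s - T.card)
              (fun x => dnfEval L (override (σ' P) (override ρ x))) then
                g (pattern U a T ρ) else 0 := by rw [if_pos hbadL]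
          _ ≤ _ := Finset.single_le_sum hnonneg hP
      have hle : prodMean (starWeight p) (fun ρ => g (pattern U a T ρ)) ≤ G :=
        prodMean_mono hnn fun ρ => hg.pattern_le U a T ρ
      calc _ ≤ _ := prodMean_mono hnn hpt
        _ = _ := prodMean_sum _ _
        _ ≤ ∑ P ∈ T.powerset, α ^ (s - T.card) * G := Finset.sum_le_sum fun P _ =>
            (ih hL' (σ' P) (s - T.card) _ (hg.comp_pattern U a T) (fun ρ => hg0 _)).trans
              (mul_le_mul_of_nonneg_left hle (pow_nonneg hα0.le _))
        _ = 2 ^ T.card * α ^ (s - T.card) * G := by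
            rw [Finset.sum_const, Finset.card_powerset, nsmul_eq_mul]
            push_cast
            ring
        -- Only an inequality, since `s - T.card` is truncated when `T` has more than `s` elements.
        _ ≤ 2 ^ T.card * (α ^ s / α ^ T.card) * G := by
            gcongr
            rw [le_div_iff₀ (by positivity), ← pow_add]
            exact pow_le_pow_of_le_one hα0.le hα1 (by omega)
        _ = _ := by rw [div_pow]; ring
    have hempty : prodMean (starWeight p) (fun ρ => if Bad s (f (pattern U a ∅ ρ)) then
        g (pattern U a ∅ ρ) else 0) = 0 := by
      -- With no free variable left the term is true, so the disjunction is constant.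
      have hconst : ∀ ρ, ¬Bad s (f (pattern U a ∅ ρ)) := by
        intro ρ hbad
        have hc : f (pattern U a ∅ ρ) = fun _ => true := by
          funext x
          have h := termEval_override_pattern hσ ∅ ∅ x ρ
          have hov : override σ (override (pattern U a ∅ ρ) x) =
              override (fun v => if v ∈ U₀.filter (σ · = none) then
                some (if v ∈ (∅ : Finset V) then decide (v ∈ (∅ : Finset V)) else a v) else σ v)
                (override ρ x) := by
            funext v
            by_cases hv : v ∈ U
            · have hσv := (Finset.mem_filter.1 hv).2
              have hv' := (Finset.mem_filter.1 hv).1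
              simp [override, hσv, hv, hv', pattern]
            · have hv' : v ∉ U₀.filter (σ · = none) := hv
              simp only [override, hv, hv', pattern, if_false]
          simp only [hf, dnfEval_cons, hov, h]
          simp
        rw [hc] at hbad
        have := hbad.eq_zero_of_const
        omega
      simp only [hconst, if_false]
      exact prodMean_const (sum_starWeight p) 0
    -- Keep only the summand `T = ∅` of `prodMean_alive`.
    have hlow : q ^ m * G ≤ prodMean (starWeight p) (fun ρ => if Alive U a ρ then g ρ else 0) := by
      rw [prodMean_alive]
      calc q ^ m * G = p ^ (∅ : Finset V).card * ((1 - p) / 2) ^ (U.card - (∅ : Finset V).card) *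
            prodMean (starWeight p) (fun ρ => g (pattern U a ∅ ρ)) := by
              simp [hq, hm, hG]
        _ ≤ _ := Finset.single_le_sum
            (f := fun T => p ^ T.card * ((1 - p) / 2) ^ (U.card - T.card) *
              prodMean (starWeight p) (fun ρ => g (pattern U a T ρ)))
            (fun T _ => mul_nonneg (mul_nonneg (pow_nonneg hp0 _) (pow_nonneg hq0 _))
              (prodMean_nonneg hnn fun ρ => hg0 _)) (Finset.empty_mem_powerset U)
    have halive : prodMean (starWeight p) (fun ρ => if Alive U a ρ then
        (if Bad s (f ρ) then g ρ else 0) else 0) ≤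
        α ^ s * prodMean (starWeight p) (fun ρ => if Alive U a ρ then g ρ else 0) := by
      rw [prodMean_alive, ← Finset.add_sum_erase _ _ (Finset.empty_mem_powerset U), hempty,
        mul_zero, zero_add]
      -- The nonempty `T` contribute `(2p/α + q) ^ m - q ^ m` in total, and `hw` bounds this by `q ^
      -- m`.
      have hbinom := Finset.sum_pow_mul_eq_add_pow (p * (2 / α)) q U
      rw [← Finset.add_sum_erase _ _ (Finset.empty_mem_powerset U)] at hbinom
      simp only [Finset.card_empty, pow_zero, one_mul, Nat.sub_zero] at hbinom
      calc _ ≤ ∑ T ∈ U.powerset.erase ∅, (p * (2 / α)) ^ T.card * q ^ (U.card - T.card) *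
              (α ^ s * G) := Finset.sum_le_sum fun T hTm => by
            have h := hT T (Finset.mem_of_mem_erase hTm) (Finset.ne_of_mem_erase hTm)
            have h' := mul_le_mul_of_nonneg_left h
              (mul_nonneg (pow_nonneg hp0 T.card) (pow_nonneg hq0 (U.card - T.card)))
            refine h'.trans_eq ?_
            rw [mul_pow]
            ring
        _ ≤ q ^ m * (α ^ s * G) := by
            rw [← Finset.sum_mul]
            refine mul_le_mul_of_nonneg_right ?_ (by positivity)
            have := hw m hmw
            linarith
        _ = α ^ s * (q ^ m * G) := by ring
        _ ≤ _ := mul_le_mul_of_nonneg_left hlow (pow_nonneg hα0.le _)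
    calc prodMean (starWeight p) (fun ρ => if Bad s (f ρ) then g ρ else 0)
        = prodMean (starWeight p) (fun ρ => (if Alive U a ρ then
            (if Bad s (f ρ) then g ρ else 0) else 0) + (if Bad s (f ρ) then
            (if Alive U a ρ then 0 else g ρ) else 0)) := by
          congr 1
          funext ρ
          split_ifs <;> simp
      _ ≤ α ^ s * prodMean (starWeight p) (fun ρ => if Alive U a ρ then g ρ else 0) +
          α ^ s * prodMean (starWeight p) (fun ρ => if Alive U a ρ then 0 else g ρ) := by
          rw [prodMean_add]
          exact add_le_add halive hdead
      _ = α ^ s * prodMean (starWeight p) g := by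
          rw [← mul_add, ← prodMean_add]
          congr 2
          funext ρ
          split_ifs <;> simp

open Classical in
/-- **Switching lemma**: with `p = 1 / (64 w)`, a random restriction turns a disjunction of
functions with decision trees of depth at most `w` into a function without a decision tree of depth
`w` with probability at most `4 ^ (-(w + 1))`. -/
theorem switching {V : Type} [Fintype V] [DecidableEq V] {w : ℕ} (hw : 1 ≤ w)
    (L : List (Finset V × (V → Bool))) (hL : ∀ τ ∈ L, τ.1.card ≤ w) :
    prodMean (starWeight (1 / (64 * w))) (fun ρ =>
      if HasDepth w (fun x => dnfEval L (override ρ x)) then 0 else 1) ≤ (1 / 4 : ℝ) ^ (w + 1) := by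
  have hw' : (1 : ℝ) ≤ w := by exact_mod_cast hw
  set p : ℝ := 1 / (64 * w) with hp
  have hp0 : 0 < p := by positivity
  have hpw : p * w = 1 / 64 := by rw [hp]; field_simp
  have hp1 : p ≤ 1 / 64 := by nlinarith
  -- With `α = 1/4` the ratio of the bases is at most `1 + 32p`, and `32pw = 1/2` gives `exp (1/2) ≤
  -- 2`.
  have hbound : ∀ m ≤ w, (p * (2 / (1 / 4)) + (1 - p) / 2) ^ m ≤ 2 * ((1 - p) / 2) ^ m := by
    intro m hm
    have hm' : (m : ℝ) ≤ w := by exact_mod_cast hm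
    have h1 : p * (2 / (1 / 4)) + (1 - p) / 2 ≤ (1 + 32 * p) * ((1 - p) / 2) := by nlinarith
    have h2 : (1 + 32 * p) ^ m ≤ 2 := by
      have h3 : 1 + 32 * p ≤ Real.exp (32 * p) := by
        have := Real.add_one_le_exp (32 * p); linarith
      calc (1 + 32 * p) ^ m ≤ Real.exp (32 * p) ^ m := by gcongr
        _ = Real.exp (m * (32 * p)) := by rw [← Real.exp_nat_mul]
        _ ≤ Real.exp (1 / 2) := Real.exp_le_exp.2 (by nlinarith)
        _ ≤ 2 := by
          have h4 : Real.exp (1 / 2) * Real.exp (1 / 2) = Real.exp 1 := by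
            rw [← Real.exp_add]; norm_num
          have := Real.exp_one_lt_d9
          nlinarith [Real.exp_pos (1 / 2)]
    calc _ ≤ ((1 + 32 * p) * ((1 - p) / 2)) ^ m :=
          pow_le_pow_left₀ (by have : p ≤ 1 := by linarith
                               have : 0 ≤ (1 - p) / 2 := by linarith
                               positivity) h1 m
      _ = (1 + 32 * p) ^ m * ((1 - p) / 2) ^ m := mul_pow _ _ _
      _ ≤ _ := mul_le_mul_of_nonneg_right h2 (pow_nonneg (by linarith) _)
  have h := switching_weighted hp0.le (by linarith) (by norm_num : (0 : ℝ) < 1 / 4) (by norm_num)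
    hbound L hL (fun _ => none) (w + 1) (fun _ => 1) (fun _ _ _ => le_rfl) (fun _ => zero_le_one)
  rw [prodMean_const (sum_starWeight p), mul_one] at h
  refine le_trans (prodMean_mono (starWeight_nonneg hp0.le (by linarith)) fun ρ => ?_) h
  by_cases hd : HasDepth w (fun x => dnfEval L (override ρ x))
  · rw [if_pos hd]
    split_ifs <;> norm_num
  · have hov : ∀ y : V → Bool, override (fun _ => none) y = y := fun y => rfl
    have hbad : Bad (w + 1) (fun x => dnfEval L (override (fun _ => none) (override ρ x))) := by
      intro k hk hk'
      exact hd (hk'.mono (by omega))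
    rw [if_neg hd, if_pos hbad]

/-! ## The second moment of a linear form chosen by a decision tree -/

/-- The mean of `H x` for uniformly random bits `x`. -/
noncomputable def coinMean {V : Type} [Fintype V] [DecidableEq V] (H : (V → Bool) → ℝ) : ℝ :=
  prodMean (fun _ => 1 / 2) H

/-- The excess of the second moment of `∑ v, χ (Z x) v * (-1) ^ x v`, where the outcome `Z x`
depends on `x`, over its value for a constant outcome. -/
noncomputable def secondMomentExcess {V β : Type} [Fintype V] [DecidableEq V] (χ : β → V → ℝ)
    (Z : (V → Bool) → β) : ℝ :=
  coinMean fun x => (∑ v, χ (Z x) v * signOfBit (x v)) ^ 2 - ∑ v, χ (Z x) v ^ 2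

theorem sum_update_of_notMem {V : Type} [DecidableEq V] {W : Finset V} {v : V} (hv : v ∉ W) (c : V → ℝ) (x : V → Bool)
    (b : Bool) : ∑ u ∈ W, c u * signOfBit (Function.update x v b u) =
      ∑ u ∈ W, c u * signOfBit (x u) :=
  Finset.sum_congr rfl fun u hu => by
    rw [Function.update_of_ne (by rintro rfl; exact hv hu)]

section SecondMoment

variable {V β : Type} [Fintype V] [DecidableEq V]

theorem sum_half_bool : ∑ _b : Bool, (1 / 2 : ℝ) = 1 := by simp

theorem coinMean_update (v : V) (H : (V → Bool) → ℝ) :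
    coinMean H = 1 / 2 * coinMean (fun x => H (Function.update x v true)) +
      1 / 2 * coinMean (fun x => H (Function.update x v false)) := by
  rw [coinMean, prodMean_update sum_half_bool v, Fintype.sum_bool]
  rfl

theorem coinMean_mono {H K : (V → Bool) → ℝ} (h : ∀ x, H x ≤ K x) : coinMean H ≤ coinMean K :=
  prodMean_mono (fun _ => by norm_num) h

theorem coinMean_const (c : ℝ) : coinMean (fun _ : V → Bool => c) = c :=
  prodMean_const sum_half_bool c

theorem signOfBit_sq (b : Bool) : signOfBit b ^ 2 = 1 := by
  cases b <;> simp [signOfBit]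

theorem abs_signOfBit (b : Bool) : |signOfBit b| = 1 := by
  cases b <;> simp [signOfBit]

theorem coinMean_sq_linear (W : Finset V) (c : V → ℝ) (A : ℝ) :
    coinMean (fun x => (A + ∑ v ∈ W, c v * signOfBit (x v)) ^ 2) = A ^ 2 + ∑ v ∈ W, c v ^ 2 := by
  induction W using Finset.induction_on generalizing A with
  | empty => simp [coinMean_const]
  | insert v W hv ih =>
    rw [coinMean_update v]
    simp only [Finset.sum_insert hv, sum_update_of_notMem hv, Function.update_self, ← add_assoc, ih]
    simp only [signOfBit, if_true, Bool.false_eq_true, if_false]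
    ring

/-- `W` holds the variables not yet queried and `A` the contribution of those already seen. A query
of `v ∈ W` moves one term of size at most 1 into `A`; dropping `-χ ^ 2` for it only increases the
mean. At a leaf the variance of the rest cancels exactly and `A ^ 2` remains. -/
theorem HasDepth.coinMean_sq_le {k : ℕ} {Z : (V → Bool) → β} (h : HasDepth k Z) {χ : β → V → ℝ}
    (hχ : ∀ z v, |χ z v| ≤ 1) (W : Finset V) (A : β → ℝ) {a : ℝ} (hA : ∀ z, |A z| ≤ a) :
    coinMean (fun x => (A (Z x) + ∑ v ∈ W, χ (Z x) v * signOfBit (x v)) ^ 2 -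
      ∑ v ∈ W, χ (Z x) v ^ 2) ≤ (a + k) ^ 2 := by
  induction h generalizing W A a with
  | const k z =>
    have h0 : coinMean (fun x => (A z + ∑ v ∈ W, χ z v * signOfBit (x v)) ^ 2 -
        ∑ v ∈ W, χ z v ^ 2) = A z ^ 2 := by
      have := coinMean_sq_linear W (χ z) (A z)
      simp only [sub_eq_add_neg, coinMean] at this ⊢
      rw [prodMean_add, this, prodMean_const sum_half_bool]
      ring
    rw [h0, ← sq_abs]
    exact pow_le_pow_left₀ (abs_nonneg _) ((hA z).trans (by simp)) 2
  | query k v Z hZ ih =>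
    have key : ∀ b, coinMean (fun x => (A (Z (Function.update x v b)) +
        ∑ u ∈ W, χ (Z (Function.update x v b)) u * signOfBit (Function.update x v b u)) ^ 2 -
        ∑ u ∈ W, χ (Z (Function.update x v b)) u ^ 2) ≤ (a + (k + 1 : ℕ)) ^ 2 := by
      intro b
      by_cases hv : v ∈ W
      · have hA' : ∀ z, |A z + χ z v * signOfBit b| ≤ a + 1 := fun z => by
          refine (abs_add_le _ _).trans (add_le_add (hA z) ?_)
          rw [abs_mul, abs_signOfBit, mul_one]
          exact hχ z v
        refine le_trans (coinMean_mono fun x => ?_) ((ih b (W.erase v) _ hA').trans_eq ?_)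
        · rw [← Finset.add_sum_erase _ _ hv, ← Finset.add_sum_erase _ _ hv,
            sum_update_of_notMem (Finset.notMem_erase v W), Function.update_self, ← add_assoc]
          nlinarith [sq_nonneg (χ (Z (Function.update x v b)) v)]
        · push_cast; ring
      · refine le_trans (coinMean_mono fun x => ?_) ((ih b W A hA).trans ?_)
        · rw [sum_update_of_notMem hv]
        -- An outcome is needed to deduce `0 ≤ a` from `hA`.
        · by_cases hne : Nonempty β
          · have := (abs_nonneg _).trans (hA hne.some)
            push_cast
            gcongr
            simp
          · exact (hne ⟨Z fun _ => b⟩).elim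
    rw [coinMean_update v]
    linarith [key true, key false]

theorem HasDepth.secondMomentExcess_le {k : ℕ} {Z : (V → Bool) → β} (h : HasDepth k Z)
    {χ : β → V → ℝ} (hχ : ∀ z v, |χ z v| ≤ 1) : secondMomentExcess χ Z ≤ (k : ℝ) ^ 2 := by
  simpa [secondMomentExcess] using
    h.coinMean_sq_le hχ Finset.univ (fun _ => 0) (a := 0) (fun _ => by simp)

theorem secondMomentExcess_le_card_sq {χ : β → V → ℝ} (hχ : ∀ z v, |χ z v| ≤ 1)
    (Z : (V → Bool) → β) : secondMomentExcess χ Z ≤ (Fintype.card V : ℝ) ^ 2 := by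
  have h : ∀ x, (∑ v, χ (Z x) v * signOfBit (x v)) ^ 2 - ∑ v, χ (Z x) v ^ 2 ≤
      (Fintype.card V : ℝ) ^ 2 := by
    intro x
    have h1 : |∑ v, χ (Z x) v * signOfBit (x v)| ≤ Fintype.card V := by
      refine (Finset.abs_sum_le_sum_abs _ _).trans ?_
      refine (Finset.sum_le_card_nsmul _ _ 1 fun v _ => ?_).trans (by simp)
      rw [abs_mul, abs_signOfBit, mul_one]
      exact hχ _ v
    have h2 : (0 : ℝ) ≤ ∑ v, χ (Z x) v ^ 2 := Finset.sum_nonneg fun v _ => sq_nonneg _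
    have h3 := pow_le_pow_left₀ (abs_nonneg _) h1 2
    rw [sq_abs] at h3
    linarith
  exact (coinMean_mono h).trans_eq (coinMean_const _)

/-- A random restriction followed by uniform bits is uniform, and the signs of the uniform bits
carry over with a factor `p` each. -/
theorem restriction_coinMean_signs (p : ℝ) (S : Finset V) (Φ : (V → Bool) → ℝ) :
    prodMean (starWeight p) (fun ρ => coinMean fun x =>
      Φ (override ρ x) * ∏ v ∈ S, signOfBit (x v)) =
    p ^ S.card * coinMean (fun y => Φ y * ∏ v ∈ S, signOfBit (y v)) := by
  have hprod : ∀ x : V → Bool, ∏ v ∈ S, signOfBit (x v) =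
      ∏ v, if v ∈ S then signOfBit (x v) else 1 := fun x => by
    rw [Finset.prod_ite_mem, Finset.univ_inter]
  -- If `v` is free, the fresh bit equals the visible bit `b`; if `v` is fixed, the fresh bit is
  -- independent of `b` and its sign averages to zero. Hence the factor `p`.
  have hlocal : ∀ (b : Bool) (v : V), ∑ z : Option Bool × Bool,
      (if z.1.getD z.2 = b then starWeight p z.1 * (1 / 2) * (if v ∈ S then signOfBit z.2 else 1)
        else 0) = 1 / 2 * (if v ∈ S then p * signOfBit b else 1) := by
    intro b v
    rw [Fintype.sum_prod_type, Fintype.sum_option]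
    by_cases hv : v ∈ S <;> cases b <;> simp [hv, starWeight, signOfBit] <;> ring
  have hglobal : ∀ y : V → Bool, ∑ ρ : V → Option Bool, ∑ x : V → Bool,
      (if override ρ x = y then (∏ v, starWeight p (ρ v)) * ((∏ _v : V, (1 / 2 : ℝ)) *
        ∏ v ∈ S, signOfBit (x v)) else 0) =
      p ^ S.card * ((∏ _v : V, (1 / 2 : ℝ)) * ∏ v ∈ S, signOfBit (y v)) := by
    intro y
    rw [← Fintype.sum_prod_type', ← (Equiv.arrowProdEquivProdArrow V _ _).sum_comp]
    have h := Finset.prod_univ_sum (fun _ : V => (Finset.univ : Finset (Option Bool × Bool)))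
      (fun v z => if z.1.getD z.2 = y v then
        starWeight p z.1 * (1 / 2) * (if v ∈ S then signOfBit z.2 else 1) else 0)
    rw [Fintype.piFinset_univ] at h
    calc _ = ∑ z : V → Option Bool × Bool, ∏ v, (if (z v).1.getD (z v).2 = y v then
          starWeight p (z v).1 * (1 / 2) * (if v ∈ S then signOfBit (z v).2 else 1) else 0) := by
          refine Finset.sum_congr rfl fun z _ => ?_
          simp only [Equiv.arrowProdEquivProdArrow, Equiv.coe_fn_mk]
          by_cases hz : override (fun v => (z v).1) (fun v => (z v).2) = y
          · have hz' : ∀ v, (z v).1.getD (z v).2 = y v := fun v => congrFun hz v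
            simp only [hz, hz', if_true]
            rw [hprod, ← Finset.prod_mul_distrib, ← Finset.prod_mul_distrib]
            exact Finset.prod_congr rfl fun v _ => by ring
          · obtain ⟨v, hv⟩ := Function.ne_iff.1 hz
            exact (if_neg hz).trans (Finset.prod_eq_zero (Finset.mem_univ v) (if_neg hv)).symm
      _ = _ := by
          rw [← h]
          simp only [hlocal]
          have hite : ∀ v, (if v ∈ S then p * signOfBit (y v) else 1) =
              (if v ∈ S then p else 1) * (if v ∈ S then signOfBit (y v) else 1) := fun v => by
            split_ifs <;> simp
          simp only [hite, Finset.prod_mul_distrib, ← hprod]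
          rw [Finset.prod_ite_mem, Finset.univ_inter, Finset.prod_const (s := S)]
          ring
  calc _ = ∑ ρ : V → Option Bool, ∑ x : V → Bool, ∑ y : V → Bool,
        Φ y * (if override ρ x = y then (∏ v, starWeight p (ρ v)) * ((∏ _v : V, (1 / 2 : ℝ)) *
          ∏ v ∈ S, signOfBit (x v)) else 0) := by
        simp only [prodMean, coinMean, mul_ite, mul_zero, Finset.sum_ite_eq, Finset.mem_univ,
          if_true, Finset.mul_sum]
        refine Finset.sum_congr rfl fun ρ _ => Finset.sum_congr rfl fun x _ => ?_
        ring
    _ = ∑ y : V → Bool, Φ y * ∑ ρ : V → Option Bool, ∑ x : V → Bool,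
        (if override ρ x = y then (∏ v, starWeight p (ρ v)) * ((∏ _v : V, (1 / 2 : ℝ)) *
          ∏ v ∈ S, signOfBit (x v)) else 0) := by
        simp only [Finset.mul_sum]
        refine (Finset.sum_congr rfl fun ρ _ => Finset.sum_comm).trans Finset.sum_comm
    _ = _ := by
        simp only [hglobal, coinMean, prodMean, Finset.mul_sum]
        refine Finset.sum_congr rfl fun y _ => ?_
        ring

/-- Subtracting `∑ v, χ (Z x) v ^ 2` removes the diagonal of the square. What is left is homogeneous
of degree 2 in the signs, so the scaling is an identity with no error term. -/
theorem restriction_secondMomentExcess (p : ℝ) (χ : β → V → ℝ) (Z : (V → Bool) → β) :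
    prodMean (starWeight p) (fun ρ => secondMomentExcess χ fun x => Z (override ρ x)) =
      p ^ 2 * secondMomentExcess χ Z := by
  have hexp : ∀ (c : V → ℝ) (x : V → Bool),
      (∑ v, c v * signOfBit (x v)) ^ 2 - ∑ v, c v ^ 2 =
      ∑ e ∈ (Finset.univ : Finset V).offDiag, c e.1 * c e.2 * ∏ v ∈ {e.1, e.2}, signOfBit (x v) := by
    intro c x
    have h1 : ∑ v, c v ^ 2 = ∑ e ∈ (Finset.univ : Finset V).diag,
        (c e.1 * signOfBit (x e.1)) * (c e.2 * signOfBit (x e.2)) := by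
      rw [Finset.sum_diag]
      refine Finset.sum_congr rfl fun v _ => ?_
      linear_combination (-(c v) ^ 2) * signOfBit_sq (x v)
    have h2 : (∑ v, c v * signOfBit (x v)) ^ 2 =
        ∑ e ∈ (Finset.univ : Finset V).diag ∪ (Finset.univ : Finset V).offDiag,
        (c e.1 * signOfBit (x e.1)) * (c e.2 * signOfBit (x e.2)) := by
      rw [Finset.diag_union_offDiag, sq, Finset.sum_mul_sum, Finset.sum_product]
    rw [h1, h2, Finset.sum_union (Finset.disjoint_diag_offDiag _), add_sub_cancel_left]
    refine Finset.sum_congr rfl fun e he => ?_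
    rw [Finset.prod_pair (Finset.mem_offDiag.1 he).2.2]
    ring
  simp only [secondMomentExcess, hexp]
  simp only [coinMean]
  simp only [prodMean_sum, Finset.mul_sum]
  refine Finset.sum_congr rfl fun e he => ?_
  have := restriction_coinMean_signs p {e.1, e.2} fun y => χ (Z y) e.1 * χ (Z y) e.2
  rw [Finset.card_pair (Finset.mem_offDiag.1 he).2.2] at this
  exact this

end SecondMoment

/-! ## Constant-depth circuits under random restrictions -/

theorem override_override {V : Type} (σ ρ : V → Option Bool) (x : V → Bool) :
    override σ (override ρ x) = override (fun v => (σ v).or (ρ v)) x := by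
  funext v
  cases h : σ v <;> simp [override, h]

theorem exists_dnf_exists_mem {V ι : Type} [DecidableEq V] {k : ℕ} (s : Finset ι)
    {f : ι → (V → Bool) → Bool} (h : ∀ i ∈ s, HasDepth k (f i)) :
    ∃ L : List (Finset V × (V → Bool)), (∀ τ ∈ L, τ.1.card ≤ k) ∧
      ∀ x, dnfEval L x = true ↔ ∃ i ∈ s, f i x = true := by
  have h' : ∀ i, ∃ L : List (Finset V × (V → Bool)), (∀ τ ∈ L, τ.1.card ≤ k) ∧
      (i ∈ s → ∀ x, f i x = dnfEval L x) := by
    intro i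
    by_cases hi : i ∈ s
    · obtain ⟨L, h1, h2⟩ := (h i hi).exists_dnf
      exact ⟨L, h1, fun _ => h2⟩
    · exact ⟨[], by simp, fun h => (hi h).elim⟩
  choose L hL hf using h'
  refine ⟨s.toList.flatMap L, fun τ hτ => ?_, fun x => ?_⟩
  · obtain ⟨i, -, hi⟩ := List.mem_flatMap.1 hτ
    exact hL i τ hi
  · simp only [dnfEval, List.any_flatMap, List.any_eq_true, Finset.mem_toList]
    refine exists_congr fun i => and_congr_right fun hi => ?_
    rw [hf i hi x, dnfEval, List.any_eq_true]

namespace Circuit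

variable {ι ο : Type} [DecidableEq ι]

/-- After the restriction `σ`, all AND and OR gates of depth at most `j` are computed by decision
trees of depth at most `t`. -/
def HasTrees (C : Circuit ι ο) (t j : ℕ) (σ : ι → Option Bool) : Prop :=
  ∀ g, (C.gate g).isAndOr = true → C.gateDepth g ≤ j →
    HasDepth t (fun x => C.gateValue (override σ x) g)

theorem hasDepth_input {t : ℕ} (ht : 1 ≤ t) (σ : ι → Option Bool) (i : ι) :
    HasDepth t (fun x : ι → Bool => override σ x i) :=
  ((HasDepth.var i).comp_override σ).mono ht

/-- NOT gates cost neither circuit depth nor tree depth, so chains of them are followed back to an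
AND gate, an OR gate or an input. -/
theorem HasTrees.hasDepth_gate {C : Circuit ι ο} {t j : ℕ} (ht : 1 ≤ t) {σ : ι → Option Bool}
    (h : C.HasTrees t j σ) (g : Fin C.numGates) (hg : C.gateDepth g ≤ j) :
    HasDepth t (fun x => C.gateValue (override σ x) g) := by
  induction hk : g.val using Nat.strong_induction_on generalizing g with
  | _ k ih =>
    subst hk
    cases hgate : C.gate g with
    | and s => exact h g (by rw [hgate]; rfl) hg
    | or s => exact h g (by rw [hgate]; rfl) hg
    | not v =>
      rw [gateDepth, hgate] at hg
      simp only [gateValue.eq_1 C _ g, hgate, Gate.eval]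
      cases v with
      | inl i => exact (hasDepth_input ht σ i).map _
      | inr u => exact (ih u u.2 ⟨u, u.2.trans g.2⟩ hg rfl).map _

theorem HasTrees.hasDepth_wire {C : Circuit ι ο} {t j : ℕ} (ht : 1 ≤ t) {σ : ι → Option Bool}
    (h : C.HasTrees t j σ) {g : Fin C.numGates} (v : ι ⊕ Fin g)
    (hv : Sum.elim (fun _ => 0) (fun u : Fin g => C.gateDepth ⟨u, u.2.trans g.2⟩) v ≤ j) :
    HasDepth t (fun x => Sum.elim (override σ x)
      (fun u : Fin g => C.gateValue (override σ x) ⟨u, u.2.trans g.2⟩) v) := by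
  cases v with
  | inl i => exact hasDepth_input ht σ i
  | inr u => exact h.hasDepth_gate ht _ hv

/-- `φ` is the identity for OR and, by De Morgan, negation for AND. -/
theorem HasTrees.exists_dnf {C : Circuit ι ο} {t j : ℕ} (ht : 1 ≤ t) {σ : ι → Option Bool}
    (h : C.HasTrees t j σ) {g : Fin C.numGates} (hg : (C.gate g).isAndOr = true)
    (hgd : C.gateDepth g ≤ j + 1) :
    ∃ (L : List (Finset ι × (ι → Bool))) (φ : Bool → Bool), (∀ τ ∈ L, τ.1.card ≤ t) ∧
      ∀ x, C.gateValue (override σ x) g = φ (dnfEval L x) := by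
  rw [gateDepth] at hgd
  simp only [gateValue.eq_1 C _ g]
  cases hgate : C.gate g with
  | not v => rw [hgate] at hg; simp [Gate.isAndOr] at hg
  | and s =>
    rw [hgate] at hgd
    have hs := Finset.sup_le_iff.1 (Nat.le_of_succ_le_succ hgd)
    obtain ⟨L, hL, hf⟩ := exists_dnf_exists_mem s fun v hv =>
      (h.hasDepth_wire ht v (hs v hv)).map fun b => !b
    refine ⟨L, fun b => !b, hL, fun x => ?_⟩
    rw [Bool.eq_iff_iff, Bool.not_eq_true', ← Bool.not_eq_true, hf x]
    simp [Gate.eval]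
  | or s =>
    rw [hgate] at hgd
    have hs := Finset.sup_le_iff.1 (Nat.le_of_succ_le_succ hgd)
    obtain ⟨L, hL, hf⟩ := exists_dnf_exists_mem s fun v hv => h.hasDepth_wire ht v (hs v hv)
    refine ⟨L, fun b => b, hL, fun x => ?_⟩
    rw [Bool.eq_iff_iff, hf x]
    simp [Gate.eval]

variable [Fintype ι]

open Classical in
theorem HasTrees.restriction_gate {C : Circuit ι ο} {t j : ℕ} (ht : 1 ≤ t) {σ : ι → Option Bool}
    (h : C.HasTrees t j σ) {g : Fin C.numGates} (hg : (C.gate g).isAndOr = true) :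
    prodMean (starWeight (1 / (64 * t))) (fun ρ => if C.gateDepth g ≤ j + 1 →
      HasDepth t (fun x => C.gateValue (override (fun v => (σ v).or (ρ v)) x) g) then 0 else 1) ≤
      (1 / 4 : ℝ) ^ (t + 1) := by
  have ht' : (1 : ℝ) ≤ t := by exact_mod_cast ht
  have hp1 : 1 / (64 * (t : ℝ)) ≤ 1 := by rw [div_le_one (by positivity)]; linarith
  by_cases hgd : C.gateDepth g ≤ j + 1
  · obtain ⟨L, φ, hL, hf⟩ := h.exists_dnf ht hg hgd
    refine le_trans (prodMean_mono (starWeight_nonneg (by positivity) hp1) fun ρ => ?_)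
      (switching ht L hL)
    by_cases hd : HasDepth t (fun x => dnfEval L (override ρ x))
    · rw [if_pos hd, if_pos]
      intro _
      simp only [← override_override, hf]
      exact hd.map φ
    · rw [if_neg hd]
      split_ifs <;> norm_num
  · simp only [hgd, false_imp_iff, if_true]
    rw [prodMean_const (sum_starWeight _)]
    positivity

-- Union bound over the AND and OR gates.
open Classical in
theorem HasTrees.restriction {C : Circuit ι ο} {t j : ℕ} (ht : 1 ≤ t) {σ : ι → Option Bool}
    (h : C.HasTrees t j σ) :
    prodMean (starWeight (1 / (64 * t))) (fun ρ =>
      if C.HasTrees t (j + 1) (fun v => (σ v).or (ρ v)) then 0 else 1) ≤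
      C.size * (1 / 4 : ℝ) ^ (t + 1) := by
  have ht' : (1 : ℝ) ≤ t := by exact_mod_cast ht
  have hp1 : 1 / (64 * (t : ℝ)) ≤ 1 := by rw [div_le_one (by positivity)]; linarith
  have hpt : ∀ ρ : ι → Option Bool,
      (if C.HasTrees t (j + 1) (fun v => (σ v).or (ρ v)) then (0 : ℝ) else 1) ≤
      ∑ g ∈ Finset.univ.filter fun g => (C.gate g).isAndOr = true, if C.gateDepth g ≤ j + 1 →
        HasDepth t (fun x => C.gateValue (override (fun v => (σ v).or (ρ v)) x) g)
          then 0 else 1 := by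
    intro ρ
    have hnn : ∀ g ∈ Finset.univ.filter fun g => (C.gate g).isAndOr = true,
        (0 : ℝ) ≤ if C.gateDepth g ≤ j + 1 →
        HasDepth t (fun x => C.gateValue (override (fun v => (σ v).or (ρ v)) x) g)
          then 0 else 1 := fun g _ => by split_ifs <;> norm_num
    split_ifs with hT
    · exact Finset.sum_nonneg hnn
    · rw [HasTrees] at hT
      push Not at hT
      obtain ⟨g, hg, hgd, hbad⟩ := hT
      refine le_trans (le_of_eq ?_)
        (Finset.single_le_sum hnn (Finset.mem_filter.2 ⟨Finset.mem_univ g, hg⟩))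
      rw [if_neg fun h => hbad (h hgd)]
  calc _ ≤ _ := prodMean_mono (starWeight_nonneg (by positivity) hp1) hpt
    _ = _ := prodMean_sum _ _
    _ ≤ ∑ g ∈ Finset.univ.filter fun g => (C.gate g).isAndOr = true, (1 / 4 : ℝ) ^ (t + 1) :=
      Finset.sum_le_sum fun g hg => h.restriction_gate ht (Finset.mem_filter.1 hg).2
    _ = _ := by rw [Finset.sum_const, nsmul_eq_mul, size]

/-- Here `m` counts the rounds still to come. In each round the failing restrictions contribute at
most `B`, by the trivial bound `card ^ 2` and `hsize`. This at most doubles the bound from the good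
ones, and dividing by `p ^ 2` costs `(64t) ^ 2`. -/
theorem HasTrees.secondMomentExcess_le {β : Type} {C : Circuit ι ο} {t d : ℕ} (ht : 1 ≤ t)
    {χ : β → ι → ℝ} (hχ : ∀ z v, |χ z v| ≤ 1) {Z : (ι → Bool) → β} {B : ℝ} (hB0 : 0 ≤ B)
    (hB : ∀ σ, C.HasTrees t d σ → secondMomentExcess χ (fun x => Z (override σ x)) ≤ B)
    (hsize : (Fintype.card ι : ℝ) ^ 2 * (C.size * (1 / 4 : ℝ) ^ (t + 1)) ≤ B) (m j : ℕ)
    (hm : j + m = d) (σ : ι → Option Bool) (h : C.HasTrees t j σ) :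
    secondMomentExcess χ (fun x => Z (override σ x)) ≤ (2 * (64 * t) ^ 2) ^ m * B := by
  classical
  have ht' : (1 : ℝ) ≤ t := by exact_mod_cast ht
  have hp1 : 1 / (64 * (t : ℝ)) ≤ 1 := by rw [div_le_one (by positivity)]; linarith
  have hnn := starWeight_nonneg (p := 1 / (64 * (t : ℝ))) (by positivity) hp1
  have hbig : (1 : ℝ) ≤ 2 * (64 * t) ^ 2 := by nlinarith
  induction m generalizing j σ with
  | zero =>
    obtain rfl : j = d := by omega
    simpa using hB σ h
  | succ m ih =>
    set u : ℝ := (2 * (64 * t) ^ 2) ^ m * B with hu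
    have hu0 : 0 ≤ u := by positivity
    have hBu : B ≤ u := le_mul_of_one_le_left hB0 (one_le_pow₀ hbig)
    have hpt : ∀ ρ, secondMomentExcess χ (fun x => Z (override σ (override ρ x))) ≤
        u + (Fintype.card ι : ℝ) ^ 2 *
          (if C.HasTrees t (j + 1) (fun v => (σ v).or (ρ v)) then 0 else 1) := by
      intro ρ
      simp only [override_override]
      split_ifs with hT
      · simpa using ih (j + 1) (by omega) _ hT
      · have := secondMomentExcess_le_card_sq hχ
          (fun x => Z (override (fun v => (σ v).or (ρ v)) x))
        linarith
    have hmean := prodMean_mono hnn hpt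
    rw [restriction_secondMomentExcess _ χ (fun x => Z (override σ x)), prodMean_add,
      prodMean_const (sum_starWeight _), prodMean_const_mul] at hmean
    have hbad := mul_le_mul_of_nonneg_left (h.restriction ht)
      (sq_nonneg (Fintype.card ι : ℝ))
    have hfin : (1 / (64 * (t : ℝ))) ^ 2 * secondMomentExcess χ (fun x => Z (override σ x)) ≤
        2 * u := by linarith
    have hmul := mul_le_mul_of_nonneg_left hfin (sq_nonneg (64 * (t : ℝ)))
    rw [← mul_assoc, ← mul_pow, mul_one_div_cancel (by positivity), one_pow, one_mul] at hmul
    refine hmul.trans_eq ?_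
    rw [hu, pow_succ]
    ring

theorem secondMomentExcess_le {κ : Type} [Fintype κ] [DecidableEq κ] [Fintype ο]
    (C : Circuit ι ο) {t d : ℕ} (ht : 1 ≤ t) (hd : C.depth ≤ d) {χ : (κ → Bool) → ι → ℝ}
    (hχ : ∀ z v, |χ z v| ≤ 1) (o : κ → ο)
    (hsize : (Fintype.card ι : ℝ) ^ 2 * (C.size * (1 / 4 : ℝ) ^ (t + 1)) ≤
      ((Fintype.card κ * t : ℕ) : ℝ) ^ 2) :
    secondMomentExcess χ (fun x k => C.eval x (o k)) ≤
      (2 * (64 * t) ^ 2) ^ d * ((Fintype.card κ * t : ℕ) : ℝ) ^ 2 := by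
  have hstart : ∀ m j, j + m = d → C.HasTrees t j (fun _ => none) → _ := fun m j hm =>
    HasTrees.secondMomentExcess_le ht hχ (Z := fun x k => C.eval x (o k)) (sq_nonneg _)
      (fun σ hσ => (HasDepth.pi fun k => ?_).secondMomentExcess_le hχ) hsize m j hm (fun _ => none)
  -- The induction starts vacuously: no AND or OR gate has depth 0.
  · refine hstart d 0 (zero_add d) fun g hg hg0 => ?_
    rw [gateDepth] at hg0
    cases hgate : C.gate g <;> rw [hgate] at hg hg0 <;> simp [Gate.depthFrom, Gate.isAndOr] at hg hg0
  · have hk := (Finset.sup_le_iff.1 hd) (o k) (Finset.mem_univ _)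
    simp only [eval]
    cases ho : C.output (o k) with
    | inl i => exact hasDepth_input ht σ i
    | inr g =>
      rw [ho] at hk
      exact hσ.hasDepth_gate ht g hk

end Circuit

/-! ## Fourier Fishing -/

/-- The characters by which the `i`-th answer enters its Fourier coefficient. -/
def blockCharacter {n : ℕ} (i : Fin n) (z : Cube n) (v : Fin n × Cube n) : ℝ :=
  if v.1 = i then (-1) ^ dotBits v.2 z else 0

theorem abs_blockCharacter_le {n : ℕ} (i : Fin n) (z : Cube n) (v : Fin n × Cube n) :
    |blockCharacter i z v| ≤ 1 := by
  unfold blockCharacter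
  split_ifs <;> simp

theorem sum_blockCharacter_sq {n : ℕ} (i : Fin n) (z : Cube n) :
    ∑ v, blockCharacter i z v ^ 2 = (2 : ℝ) ^ n := by
  rw [Fintype.sum_prod_type, Finset.sum_eq_single i]
  · simp [blockCharacter, ← pow_mul, mul_comm]
  · intro j _ hj
    simp [blockCharacter, hj]
  · simp

theorem sum_blockCharacter_mul_sq {n : ℕ} (i : Fin n) (z : Cube n) (x : Fin n × Cube n → Bool) :
    (∑ v, blockCharacter i z v * signOfBit (x v)) ^ 2 =
      (2 : ℝ) ^ n * cubeFourier (fun y => x (i, y)) z ^ 2 := by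
  have h : ∑ v, blockCharacter i z v * signOfBit (x v) =
      ∑ y : Cube n, (-1 : ℝ) ^ dotBits y z * signOfBit (x (i, y)) := by
    rw [Fintype.sum_prod_type, Finset.sum_eq_single i]
    · simp [blockCharacter]
    · intro j _ hj
      simp [blockCharacter, hj]
    · simp
  rw [h, cubeFourier, mul_pow, div_pow, Real.sq_sqrt (by positivity), one_pow, ← mul_assoc,
    mul_one_div_cancel (by positivity), one_mul]

/-- Pointwise, a square is at least 1 if the modulus is at least 1, and at least 3 more if it is at
least 2; `0.75 + 3 * 0.25 = 3/2`. -/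
theorem FourierFishingValid.sum_sq_ge {n : ℕ} {f : Fin n → Cube n → Bool} {z : Fin n → Cube n}
    (h : FourierFishingValid f z) : (3 / 2 : ℝ) * n ≤ ∑ i, cubeFourier (f i) (z i) ^ 2 := by
  classical
  obtain ⟨h1, h2⟩ := h
  have hpt : ∀ i, (if 1 ≤ |cubeFourier (f i) (z i)| then (1 : ℝ) else 0) +
      3 * (if 2 ≤ |cubeFourier (f i) (z i)| then (1 : ℝ) else 0) ≤
      cubeFourier (f i) (z i) ^ 2 := by
    intro i
    rw [← sq_abs]
    split_ifs <;> nlinarith [sq_nonneg |cubeFourier (f i) (z i)|]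
  have hsum := Finset.sum_le_sum fun i (_ : i ∈ Finset.univ) => hpt i
  rw [Finset.sum_add_distrib, ← Finset.mul_sum, Finset.sum_boole, Finset.sum_boole] at hsum
  have h1' : (75 / 100 : ℝ) * n ≤
      ((Finset.univ.filter fun i => 1 ≤ |cubeFourier (f i) (z i)|).card : ℝ) := by convert h1
  have h2' : (25 / 100 : ℝ) * n ≤
      ((Finset.univ.filter fun i => 2 ≤ |cubeFourier (f i) (z i)|).card : ℝ) := by convert h2
  linarith

open Classical in
theorem FishingCircuit.coinMean_valid {n : ℕ} (C : FishingCircuit n) :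
    coinMean (fun x : Fin n × Cube n → Bool =>
      if FourierFishingValid (fun i y => x (i, y)) (C.answer fun i y => x (i, y)) then 1 else 0) =
    C.successProb := by
  have hcard : (Fintype.card (Fin n → Cube n → Bool) : ℝ) = ∏ _v : Fin n × Cube n, (2 : ℝ) := by
    rw [← Fintype.card_congr (Equiv.curry (Fin n) (Cube n) Bool), Finset.prod_const]
    simp
  have hsum := ((Equiv.curry (Fin n) (Cube n) Bool).sum_comp fun f : Fin n → Cube n → Bool =>
    if FourierFishingValid f (C.answer f) then (1 : ℝ) else 0).trans (Finset.sum_boole _ _)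
  rw [coinMean, prodMean, FishingCircuit.successProb, hcard, ← Finset.mul_sum,
    Finset.prod_div_distrib, Finset.prod_const_one, one_div_mul_eq_div, ← hsum]
  rfl

/-- Both sides bound the mean of `N * ∑ i, cubeFourier (f i) (z i) ^ 2`: from below by its part on
successful inputs, from above block by block. -/
theorem FishingCircuit.successProb_le {n : ℕ} (C : FishingCircuit n) {B : ℝ}
    (hB : ∀ i, secondMomentExcess (blockCharacter i)
      (fun (x : Fin n × Cube n → Bool) j => C.eval x (i, j)) ≤ B) :
    (3 / 2 : ℝ) * n * 2 ^ n * C.successProb ≤ n * (2 ^ n + B) := by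
  classical
  have hi : ∀ i, coinMean (fun x : Fin n × Cube n → Bool => (2 : ℝ) ^ n *
      cubeFourier (fun y => x (i, y)) (C.answer (fun i y => x (i, y)) i) ^ 2) ≤ 2 ^ n + B := by
    intro i
    have h := hB i
    simp only [secondMomentExcess, sum_blockCharacter_sq, sum_blockCharacter_mul_sq, sub_eq_add_neg,
      coinMean] at h
    rw [prodMean_add, prodMean_const sum_half_bool] at h
    have h' : coinMean (fun x : Fin n × Cube n → Bool => (2 : ℝ) ^ n *
      cubeFourier (fun y => x (i, y)) (C.answer (fun i y => x (i, y)) i) ^ 2) + -2 ^ n ≤ B := h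
    linarith
  have hsum : coinMean (fun x : Fin n × Cube n → Bool => ∑ i, (2 : ℝ) ^ n *
      cubeFourier (fun y => x (i, y)) (C.answer (fun i y => x (i, y)) i) ^ 2) ≤
      n * (2 ^ n + B) := by
    rw [coinMean, prodMean_sum]
    exact (Finset.sum_le_card_nsmul _ _ _ fun i _ => hi i).trans_eq (by simp [mul_add])
  refine le_trans ?_ hsum
  rw [← C.coinMean_valid, coinMean, ← prodMean_const_mul]
  refine coinMean_mono fun x => ?_
  rw [← Finset.mul_sum]
  split_ifs with hv
  · have := mul_le_mul_of_nonneg_left hv.sum_sq_ge (by positivity : (0 : ℝ) ≤ 2 ^ n)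
    linarith
  · rw [mul_zero]
    exact mul_nonneg (by positivity) (Finset.sum_nonneg fun i _ => sq_nonneg _)

theorem FishingCircuit.pow_le_of_successProb {n t d : ℕ} (hn : 1 ≤ n) (ht : 1 ≤ t)
    (C : FishingCircuit n) (hd : C.depth ≤ d) (hsize : (4 : ℝ) ^ n * C.size ≤ 4 ^ t)
    (hC : (99 / 100 : ℝ) ≤ C.successProb) :
    (48 / 100 : ℝ) * 2 ^ n ≤ (2 * (64 * t) ^ 2) ^ d * (n * t) ^ 2 := by
  have ht' : (1 : ℝ) ≤ t := by exact_mod_cast ht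
  have hn' : (0 : ℝ) < n := by exact_mod_cast hn
  have hsize' : (Fintype.card (Fin n × Cube n) : ℝ) ^ 2 * (C.size * (1 / 4 : ℝ) ^ (t + 1)) ≤
      ((Fintype.card (Fin n) * t : ℕ) : ℝ) ^ 2 := by
    have hcard : (Fintype.card (Fin n × Cube n) : ℝ) ^ 2 = n ^ 2 * 4 ^ n := by
      simp only [Fintype.card_prod, Fintype.card_fin, Fintype.card_pi, Fintype.card_bool,
        Finset.prod_const, Finset.card_univ, Nat.cast_mul, Nat.cast_pow, Nat.cast_ofNat]
      rw [mul_pow, ← pow_mul, mul_comm n 2, pow_mul]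
      norm_num
    rw [hcard, Fintype.card_fin]
    push_cast
    calc (n : ℝ) ^ 2 * 4 ^ n * (C.size * (1 / 4 : ℝ) ^ (t + 1))
        = n ^ 2 * (1 / 4 : ℝ) ^ (t + 1) * (4 ^ n * C.size) := by ring
      _ ≤ n ^ 2 * (1 / 4 : ℝ) ^ (t + 1) * 4 ^ t := by gcongr
      _ = n ^ 2 * (1 / 4) := by
        have h : (1 / 4 : ℝ) ^ t * 4 ^ t = 1 := by rw [← mul_pow]; norm_num
        rw [pow_succ]
        linear_combination ((n : ℝ) ^ 2 * (1 / 4)) * h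
      _ ≤ (n * t) ^ 2 := by
        rw [mul_pow]
        gcongr
        nlinarith
  have h := C.successProb_le (B := (2 * (64 * t) ^ 2) ^ d * (n * t) ^ 2) fun i => by
    have := C.secondMomentExcess_le ht hd (abs_blockCharacter_le i) (fun j => (i, j)) hsize'
    simpa using this
  have h2 : (3 / 2 : ℝ) * n * 2 ^ n * (99 / 100) ≤ (3 / 2 : ℝ) * n * 2 ^ n * C.successProb := by
    gcongr
  have h3 : (n : ℝ) * ((3 / 2 : ℝ) * 2 ^ n * (99 / 100)) ≤
      n * (2 ^ n + (2 * (64 * t) ^ 2) ^ d * (n * t) ^ 2) := by linarith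
  have h4 := le_of_mul_le_mul_left h3 hn'
  have h5 : (0 : ℝ) < 2 ^ n := by positivity
  linarith

/-! ### Choice of parameters -/

theorem eventually_const_mul_sq_le_rpow {a : ℝ} (ha : 0 < a) (K : ℝ) :
    ∀ᶠ n : ℕ in Filter.atTop, K * (n : ℝ) ^ 2 ≤ ((2 : ℝ) ^ n) ^ a := by
  have hr : (1 : ℝ) < 2 ^ a := Real.one_lt_rpow (by norm_num) ha
  have h := (tendsto_pow_const_div_const_pow_of_one_lt 2 hr).const_mul K
  rw [mul_zero] at h
  filter_upwards [h.eventually_le_const one_pos] with n hn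
  have hpos : (0 : ℝ) < (2 ^ a) ^ n := by positivity
  rw [← Real.rpow_natCast 2 n, ← Real.rpow_mul (by norm_num), mul_comm (n : ℝ), Real.rpow_mul
    (by norm_num), Real.rpow_natCast]
  rwa [← mul_div_assoc, div_le_one hpos] at hn

theorem mainTheorem2 :
    ∃ c : ℝ, 0 < c ∧ ∀ d : ℕ, ∃ n₀ : ℕ, ∀ n : ℕ, n₀ ≤ n → ∀ C : FishingCircuit n,
      Circuit.depth C ≤ d → (99 / 100 : ℝ) ≤ FishingCircuit.successProb C →
        Real.exp (c * ((2 : ℝ) ^ n) ^ (1 / (2 * (d : ℝ) + 8))) ≤ (Circuit.size C : ℝ) := by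
  refine ⟨1, one_pos, fun d => ?_⟩
  -- Here `32768 = 2 * 128 ^ 2` comes from `2 * (64t) ^ 2` with `t ≤ 2R`.
  obtain ⟨n₀, hn₀⟩ := Filter.eventually_atTop.1 (eventually_const_mul_sq_le_rpow
    (a := 1 / (2 * (d : ℝ) + 8)) (by positivity) (9 * 32768 ^ d))
  refine ⟨max n₀ 1, fun n hn C hd hC => ?_⟩
  by_contra! hsize
  have hn1 : 1 ≤ n := (le_max_right _ _).trans hn
  have hn1' : (1 : ℝ) ≤ n := by exact_mod_cast hn1
  have hR := hn₀ n ((le_max_left _ _).trans hn)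
  set R : ℝ := ((2 : ℝ) ^ n) ^ (1 / (2 * (d : ℝ) + 8)) with hRdef
  have hRpow : R ^ (2 * d + 8) = 2 ^ n := by
    rw [hRdef, ← Real.rpow_natCast, ← Real.rpow_mul (by positivity)]
    push_cast
    rw [one_div_mul_cancel (by positivity), Real.rpow_one]
  have hK : (1 : ℝ) ≤ 32768 ^ d := one_le_pow₀ (by norm_num)
  have hR9 : 9 * (n : ℝ) ^ 2 ≤ R := by nlinarith [sq_nonneg (n : ℝ)]
  have hR1 : 1 ≤ R := by nlinarith
  -- The summand `2 * n` outweighs the factor `4 ^ n` from the squared number of inputs, and `⌈R⌉₊`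
  -- outweighs the size, which is below `exp R`.
  set t := 2 * n + ⌈R⌉₊ with ht
  have htR : (t : ℝ) ≤ 2 * R := by
    have := Nat.ceil_lt_add_one (zero_le_one.trans hR1)
    rw [ht]
    push_cast
    nlinarith
  have hS : (4 : ℝ) ^ n * C.size ≤ 4 ^ t := by
    have h1 : (C.size : ℝ) ≤ 4 ^ ⌈R⌉₊ := by
      refine hsize.le.trans ?_
      rw [one_mul]
      calc Real.exp R ≤ Real.exp (⌈R⌉₊ * 1) := Real.exp_le_exp.2 (by simpa using Nat.le_ceil R)
        _ = Real.exp 1 ^ ⌈R⌉₊ := Real.exp_nat_mul _ _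
        _ ≤ 4 ^ ⌈R⌉₊ := by
          gcongr
          linarith [Real.exp_one_lt_d9]
    calc (4 : ℝ) ^ n * C.size ≤ 4 ^ (2 * n) * 4 ^ ⌈R⌉₊ := by
          gcongr
          · norm_num
          · omega
      _ = 4 ^ t := by rw [ht, pow_add]
  have hfinal := C.pow_le_of_successProb hn1 (by omega) hd hS hC
  have hupper : (2 * (64 * (t : ℝ)) ^ 2) ^ d * (n * t) ^ 2 ≤
      4 * 32768 ^ d * n ^ 2 * R ^ (2 * d + 2) := by
    calc (2 * (64 * (t : ℝ)) ^ 2) ^ d * (n * t) ^ 2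
        ≤ (2 * (64 * (2 * R)) ^ 2) ^ d * (n * (2 * R)) ^ 2 := by gcongr
      _ = (32768 * R ^ 2) ^ d * (n * (2 * R)) ^ 2 := by
        congr 2
        ring
      _ = _ := by
        rw [mul_pow, ← pow_mul, pow_add]
        ring
  have hlower : 4 * 32768 ^ d * (n : ℝ) ^ 2 * R ^ (2 * d + 2) < 48 / 100 * 2 ^ n := by
    calc 4 * 32768 ^ d * (n : ℝ) ^ 2 * R ^ (2 * d + 2)
        = (4 / 9) * (9 * 32768 ^ d * n ^ 2) * R ^ (2 * d + 2) := by ring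
      _ ≤ (4 / 9) * R * R ^ (2 * d + 2) := by gcongr
      _ = (4 / 9) * R ^ (2 * d + 3) := by ring
      -- One factor `R` has absorbed `n ^ 2` and the constants; the exponent `2d + 3` would already
      -- do.
      _ ≤ (4 / 9) * R ^ (2 * d + 8) := by
        gcongr
        norm_num
      _ < 48 / 100 * 2 ^ n := by
        rw [hRpow]
        have : (0 : ℝ) < 2 ^ n := by positivity
        linarith
  linarith
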